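/- Let $n\ge 0$ be an integer and let $\operatorname{Toep}_n(\mathbb{C})\subseteq\mathbb{C}^{n\times n}$ be the linear space of complex $n\times n$ Toeplitz matrices, i.e. of the matrices $(a_{i,j})$ with $a_{i,j}=a_{k,l}$ whenever $j-i=l-k$. For $r\ge 1$ let $$\rho_r:\operatorname{Toep}_n(\mathbb{C})^r\to\mathbb{C}^{n\times n},\qquad \rho_r(T_1,\dots,T_r)=T_1T_2\cdots T_r .$$ Regard $\operatorname{Toep}_n(\mathbb{C})^r\subseteq\mathbb{C}^{rn^2}$ and $\mathbb{C}^{n\times n}\simeq\mathbb{C}^{n^2}$ as algebraic varieties through the matrix entries; a property is said to hold at a generic point of such a variety $X$ if the points of $X$ at which it fails are contained in a proper Zariski closed subset of $X$. (a) For every $r\ge\lfloor n/2\rfloor+1$, at a generic point $\tau=(T_1,\dots,T_r)\in\operatorname{Toep}_n(\mathbb{C})^r$ the differential $(d\rho_r)_\tau:\operatorname{Toep}_n(\mathbb{C})^r\to\mathbb{C}^{n\times n}$ has full rank $n^2$. (b) Consequently, for a generic $A\in\mathbb{C}^{n\times n}$ there exist $r=\lfloor n/2\rfloor+1$ Toeplitz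 matrices $T_1,\dots,T_r\in\operatorname{Toep}_n(\mathbb{C})$ such that $A=T_1T_2\cdots T_r$. -/

import Mathlib

/-- The space `Toep_n(ℂ)` of `n × n` complex Toeplitz matrices, i.e. of the matrices whose
`(i, j)` entry depends only on `j - i`, as a linear subspace of `ℂ^{n × n}`. -/
def toeplitz (n : ℕ) : Submodule ℂ (Matrix (Fin n) (Fin n) ℂ) where
  carrier := {A | ∀ i j k l : Fin n, (j : ℤ) - (i : ℤ) = (l : ℤ) - (k : ℤ) → A i j = A k l}
  zero_mem' := by
    intro i j k l _
    rfl
  add_mem' := by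
    intro A B hA hB i j k l h
    rw [Matrix.add_apply, Matrix.add_apply, hA i j k l h, hB i j k l h]
  smul_mem' := by
    intro c A hA i j k l h
    rw [Matrix.smul_apply, Matrix.smul_apply, hA i j k l h]

/-- The map `ρ_r : Toep_n(ℂ)^r → ℂ^{n × n}`, `(T_1, …, T_r) ↦ T_1 ⋯ T_r`, the product being taken
in this order. -/
def toeplitzProd (n r : ℕ) (T : Fin r → toeplitz n) : Matrix (Fin n) (Fin n) ℂ :=
  (List.ofFn fun i => (T i : Matrix (Fin n) (Fin n) ℂ)).prod

/-- A set `X` sits in the affine space `ℂ^σ` through the inclusion `c : X ↪ ℂ^σ`. A subset of `X`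
is closed in the (subspace) Zariski topology of `X` when it is the set of points of `X`
whose coordinates are common zeros of a family `S` of complex polynomials. -/
def IsZariskiClosed {X σ : Type*} (c : X ↪ (σ → ℂ)) (Z : Set X) : Prop :=
  ∃ S : Set (MvPolynomial σ ℂ), Z = {x | ∀ p ∈ S, MvPolynomial.eval (c x) p = 0}

/-- A property `P` holds at a generic point of `X` when the points of `X` at which `P` fails are
contained in a proper Zariski closed subset of `X`. -/
def HoldsGenerically {X σ : Type*} (c : X ↪ (σ → ℂ)) (P : X → Prop) : Prop :=
  ∃ Z : Set X, IsZariskiClosed c Z ∧ Z ≠ Set.univ ∧ {x | ¬ P x} ⊆ Z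

/-- The identification `ℂ^{n × n} ≃ ℂ^{n²}` through the entries. -/
def matrixCoords (n : ℕ) : Matrix (Fin n) (Fin n) ℂ ↪ (Fin n × Fin n → ℂ) where
  toFun A := fun ij => A ij.1 ij.2
  inj' := by
    intro A B h
    ext i j
    exact congrFun h (i, j)

/-- The inclusion of `Toep_n(ℂ)^r` in `ℂ^{r n²}` through the entries of the `r` matrices. -/
def toeplitzCoords (n r : ℕ) : (Fin r → toeplitz n) ↪ (Fin r × Fin n × Fin n → ℂ) where
  toFun T := fun kij => (T kij.1 : Matrix (Fin n) (Fin n) ℂ) kij.2.1 kij.2.2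
  inj' := by
    intro S T h
    funext k
    apply Subtype.ext
    ext i j
    exact congrFun h (k, i, j)

/-!
The differential of `(T_1, …, T_r) ↦ T_1 ⋯ T_r` sends `(X_1, …, X_r)` to the sum of the products in
which `T_k` is replaced by `X_k`. Being onto is a Zariski open condition on `(T_1, …, T_r)`, so that
(a) needs one point at which the differential is onto, and this point is found by a degeneration.

Put `T_k = 1 + t ^ k W_k` with fixed Toeplitz matrices `W_k`. The image of the differential contains
`X T_2 ⋯ T_r` for every Toeplitz matrix `X`, and also the difference of the products with `X` in
position `k + 1` and in position `k`, divided by `t ^ k`, which is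
`T_1 ⋯ T_{k-1} (W_k X - t X W_{k+1}) T_{k+2} ⋯ T_r`. As `t → 0` these tend to `X` and to `W_k X`.
If the matrices `X` and `W_k X`, for `k < r`, span the whole matrix space, the differential is
therefore onto for small `t ≠ 0`
(`limitSubmodule_toeplitzCurve_eq_top`, `exists_eq_top_of_limitSubmodule_eq_top`).

They do span it for `W_k = J ^ (n - k) + (Jᵀ) ^ (n - k)`, where `J` is the nilpotent shift and
`k ≤ n / 2` (`eq_top_of_toeplitz_of_rowSwap_mul`). Left multiplication by `W_k` moves the last `k`
rows to the top and the first `k` rows to the bottom, which allows an induction from the outer rows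
to the middle one.

For (b), the map is open at a point where its differential is onto, so its image lies in no
hypersurface, and its components are algebraically independent. By Chevalley's theorem the image
of the induced morphism of spectra contains a nonempty open set, and by the Nullstellensatz the
closed points of that set come from complex points
(`exists_ne_zero_forall_exists_eval_eq`).
-/

/-! ### Toeplitz multiples spanning the matrix space -/

/-- The `n × n` Toeplitz matrix whose diagonal number `d` (the entries `(i, j)` with `j - i = d`)
is constantly `x d`. -/
def toeplitzOf (n : ℕ) (x : ℤ → ℂ) : Matrix (Fin n) (Fin n) ℂ :=
  Matrix.of fun i j => x ((j : ℤ) - (i : ℤ))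

theorem toeplitzOf_apply (n : ℕ) (x : ℤ → ℂ) (i j : Fin n) :
    toeplitzOf n x i j = x ((j : ℤ) - (i : ℤ)) := rfl

theorem toeplitzOf_mem (n : ℕ) (x : ℤ → ℂ) : toeplitzOf n x ∈ toeplitz n := by
  intro i j k l h
  rw [toeplitzOf_apply, toeplitzOf_apply, h]

/-- The sum of the `d`-th power of the nilpotent shift matrix and of its transpose, where
`d = n - (i + 1)`. Left multiplication by it moves the last `i + 1` rows to the top and the first
`i + 1` rows to the bottom, and erases the rest when `2 * (i + 1) ≤ n`. -/
def rowSwap (n i : ℕ) : Matrix (Fin n) (Fin n) ℂ :=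
  toeplitzOf n fun d =>
    (if d = (n : ℤ) - (i + 1) then 1 else 0) + (if d = -((n : ℤ) - (i + 1)) then 1 else 0)

theorem toeplitzOf_indicator_mul_apply (n : ℕ) (x : ℤ → ℂ) (e : ℤ) (a b : Fin n) :
    (toeplitzOf n (fun d => if d = e then 1 else 0) * toeplitzOf n x) a b =
      if 0 ≤ (a : ℤ) + e ∧ (a : ℤ) + e < n then x ((b : ℤ) - a - e) else 0 := by
  rw [Matrix.mul_apply]
  simp only [toeplitzOf_apply, ite_mul, one_mul, zero_mul]
  split_ifs with h
  · obtain ⟨c, hc⟩ : ∃ c : Fin n, (c : ℤ) = a + e :=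
      ⟨⟨((a : ℤ) + e).toNat, by omega⟩, by simp [h.1]⟩
    rw [Finset.sum_eq_single c]
    · rw [if_pos (by omega)]
      congr 1
      omega
    · intro c' _ hne
      exact if_neg fun h' => hne (Fin.ext (by omega))
    · simp
  · refine Finset.sum_eq_zero fun c _ => if_neg fun h' => h ?_
    have := c.2
    omega

theorem rowSwap_mul_apply (n i : ℕ) (x : ℤ → ℂ) (a b : Fin n) :
    (rowSwap n i * toeplitzOf n x) a b =
      (if (a : ℤ) + (n - (i + 1)) < n ∧ 0 ≤ (a : ℤ) + (n - (i + 1)) then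
        x ((b : ℤ) - a - (n - (i + 1))) else 0) +
      (if 0 ≤ (a : ℤ) - (n - (i + 1)) ∧ (a : ℤ) - (n - (i + 1)) < n then
        x ((b : ℤ) - a + (n - (i + 1))) else 0) := by
  have : rowSwap n i = toeplitzOf n (fun d => if d = (n : ℤ) - (i + 1) then 1 else 0) +
      toeplitzOf n (fun d => if d = -((n : ℤ) - (i + 1)) then 1 else 0) := rfl
  rw [this, add_mul, Matrix.add_apply, toeplitzOf_indicator_mul_apply,
    toeplitzOf_indicator_mul_apply]
  simp only [sub_eq_add_neg, neg_neg, and_comm]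

/-- Once the elementary matrices of all rows outside `s` lie in `S`, only the rows in `s` decide
membership in `S`. -/
theorem mem_of_eq_on_rows {n : ℕ} {S : Submodule ℂ (Matrix (Fin n) (Fin n) ℂ)} {s : Set (Fin n)}
    (hS : ∀ a ∉ s, ∀ b, Matrix.single a b (1 : ℂ) ∈ S) {M N : Matrix (Fin n) (Fin n) ℂ}
    (hM : M ∈ S) (h : ∀ a ∈ s, ∀ b, M a b = N a b) : N ∈ S := by
  have key : N - M ∈ S := by
    rw [Matrix.matrix_eq_sum_single (N - M)]
    refine S.sum_mem fun a _ => S.sum_mem fun b _ => ?_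
    by_cases ha : a ∈ s
    · simp [h a ha b]
    · have := S.smul_mem ((N - M) a b) (hS a ha b)
      rwa [Matrix.smul_single, smul_eq_mul, mul_one] at this
  simpa using S.add_mem key hM

/-- The Toeplitz matrices and their left multiples by the matrices `rowSwap n i`, `i < n / 2`,
span the space of all matrices. The elementary matrices are produced row by row, from the first and
last rows inwards: modulo the rows already treated, `rowSwap n k` times a one-diagonal Toeplitz
matrix meets the rows `k` and `n - 1 - k` in a single entry, and the two entries missed in this way
come from one-diagonal Toeplitz matrices. -/
theorem eq_top_of_toeplitz_of_rowSwap_mul {n : ℕ} {S : Submodule ℂ (Matrix (Fin n) (Fin n) ℂ)}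
    (hT : ∀ x, toeplitzOf n x ∈ S)
    (hW : ∀ i < n / 2, ∀ x, rowSwap n i * toeplitzOf n x ∈ S) : S = ⊤ := by
  have rows : ∀ k ≤ n / 2, ∀ a : Fin n, ((a : ℕ) < k ∨ n - k ≤ a) →
      ∀ b, Matrix.single a b (1 : ℂ) ∈ S := by
    intro k
    induction k with
    | zero => intro _ a ha; have := a.2; omega
    | succ k ih =>
      intro hk a ha b
      have hS : ∀ a ∉ {a : Fin n | k ≤ (a : ℕ) ∧ (a : ℕ) < n - k}, ∀ b,
          Matrix.single a b (1 : ℂ) ∈ S := by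
        intro a ha b
        refine ih (by omega) a ?_ b
        simp only [Set.mem_ofPred_eq] at ha
        omega
      have hb := b.2
      have han := a.2
      by_cases hold : a ∉ {a : Fin n | k ≤ (a : ℕ) ∧ (a : ℕ) < n - k}
      · exact hS a hold b
      simp only [Set.mem_ofPred_eq, not_not] at hold
      -- In row `k` only the last entry escapes `rowSwap n k`, in row `n - 1 - k` only the first one.
      rcases (show (a : ℕ) = k ∨ (a : ℕ) = n - 1 - k by omega) with hak | hak
      · by_cases hbn : (b : ℕ) = n - 1
        · refine mem_of_eq_on_rows hS
            (hT fun d => if d = (n : ℤ) - 1 - k then 1 else 0) fun c hc d => ?_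
          simp only [Set.mem_ofPred_eq] at hc
          have := d.2
          simp only [toeplitzOf_apply, Matrix.single_apply, Fin.ext_iff]
          congr 1
          simp only [eq_iff_iff]
          omega
        · refine mem_of_eq_on_rows hS
            (hW k (by omega) fun d => if d = (b : ℤ) - (n - 1) then 1 else 0) fun c hc d => ?_
          simp only [Set.mem_ofPred_eq] at hc
          have := d.2
          simp only [rowSwap_mul_apply, Matrix.single_apply, Fin.ext_iff]
          split_ifs <;> first | omega | simp
      · by_cases hbn : (b : ℕ) = 0
        · refine mem_of_eq_on_rows hS
            (hT fun d => if d = -((n : ℤ) - 1 - k) then 1 else 0) fun c hc d => ?_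
          simp only [Set.mem_ofPred_eq] at hc
          have := d.2
          simp only [toeplitzOf_apply, Matrix.single_apply, Fin.ext_iff]
          congr 1
          simp only [eq_iff_iff]
          omega
        · refine mem_of_eq_on_rows hS
            (hW k (by omega) fun d => if d = (b : ℤ) then 1 else 0) fun c hc d => ?_
          simp only [Set.mem_ofPred_eq] at hc
          have := d.2
          simp only [rowSwap_mul_apply, Matrix.single_apply, Fin.ext_iff]
          split_ifs <;> first | omega | simp
  have hS : ∀ a ∉ {a : Fin n | n / 2 ≤ (a : ℕ) ∧ (a : ℕ) < n - n / 2}, ∀ b,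
      Matrix.single a b (1 : ℂ) ∈ S := by
    intro a ha b
    refine rows _ le_rfl a ?_ b
    simp only [Set.mem_ofPred_eq] at ha
    omega
  -- At most the middle row is left, where a one-diagonal Toeplitz matrix has a single entry.
  have all : ∀ a b, Matrix.single a b (1 : ℂ) ∈ S := by
    intro a b
    by_cases ha : a ∉ {a : Fin n | n / 2 ≤ (a : ℕ) ∧ (a : ℕ) < n - n / 2}
    · exact hS a ha b
    simp only [Set.mem_ofPred_eq, not_not] at ha
    refine mem_of_eq_on_rows hS
      (hT fun d => if d = (b : ℤ) - a then 1 else 0) fun c hc d => ?_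
    simp only [Set.mem_ofPred_eq] at hc
    simp only [toeplitzOf_apply, Matrix.single_apply, Fin.ext_iff]
    congr 1
    simp only [eq_iff_iff]
    omega
  exact Submodule.eq_top_iff'.2 fun N =>
    mem_of_eq_on_rows (s := ∅) (fun a _ => all a) S.zero_mem (by simp)

/-! ### The differential of the product map -/

/-- `toeplitzProd n r` as a continuous multilinear map. -/
noncomputable def toeplitzProdMultilinear (n r : ℕ) :
    ContinuousMultilinearMap ℂ (fun _ : Fin r => toeplitz n) (Matrix (Fin n) (Fin n) ℂ) :=
  (ContinuousMultilinearMap.mkPiAlgebraFin ℂ r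
    (Matrix (Fin n) (Fin n) ℂ)).compContinuousLinearMap fun _ => (toeplitz n).subtypeL

section Norm

-- The norm is auxiliary: it induces the entrywise topology that the Fréchet derivative refers to.
attribute [local instance] Matrix.normedAddCommGroup Matrix.normedSpace

theorem hasStrictFDerivAt_toeplitzProd (n r : ℕ) (τ : Fin r → toeplitz n) :
    HasStrictFDerivAt (toeplitzProd n r) ((toeplitzProdMultilinear n r).linearDeriv τ) τ :=
  (toeplitzProdMultilinear n r).hasStrictFDerivAt τ

theorem hasFDerivAt_toeplitzProd (n r : ℕ) (τ : Fin r → toeplitz n) :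
    HasFDerivAt (toeplitzProd n r) ((toeplitzProdMultilinear n r).linearDeriv τ) τ :=
  (hasStrictFDerivAt_toeplitzProd n r τ).hasFDerivAt

theorem map_nhds_toeplitzProd {n r : ℕ} {τ : Fin r → toeplitz n}
    (h : ((toeplitzProdMultilinear n r).linearDeriv τ).range = ⊤) :
    Filter.map (toeplitzProd n r) (nhds τ) = nhds (toeplitzProd n r τ) :=
  haveI : CompleteSpace (toeplitz n) :=
    (Submodule.closed_of_finiteDimensional (toeplitz n)).completeSpace_coe
  (hasStrictFDerivAt_toeplitzProd n r τ).map_nhds_eq_of_surj h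

theorem differentiableAt_toeplitzProd (n r : ℕ) (τ : Fin r → toeplitz n) :
    DifferentiableAt ℂ (toeplitzProd n r) τ :=
  (hasFDerivAt_toeplitzProd n r τ).differentiableAt

theorem fderiv_toeplitzProd (n r : ℕ) (τ : Fin r → toeplitz n) :
    fderiv ℂ (toeplitzProd n r) τ = (toeplitzProdMultilinear n r).linearDeriv τ :=
  (hasFDerivAt_toeplitzProd n r τ).fderiv

end Norm

theorem linearDeriv_toeplitzProd_apply {n r : ℕ} (τ X : Fin r → toeplitz n) :
    (toeplitzProdMultilinear n r).linearDeriv τ X =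
      ∑ k, (List.ofFn fun i => ((Function.update τ k (X k) i : toeplitz n) :
        Matrix (Fin n) (Fin n) ℂ)).prod := by
  rw [ContinuousMultilinearMap.linearDeriv_apply]
  rfl

/-- The differential at a tuple concentrated in position `k`. -/
theorem prod_update_mem_range {n r : ℕ} (τ : Fin r → toeplitz n) (k : Fin r) (x : toeplitz n) :
    (List.ofFn fun i => ((Function.update τ k x i : toeplitz n) :
      Matrix (Fin n) (Fin n) ℂ)).prod ∈
      ((toeplitzProdMultilinear n r).linearDeriv τ).range := by
  refine ⟨Pi.single k x, ?_⟩
  change (toeplitzProdMultilinear n r).linearDeriv τ (Pi.single k x) = _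
  rw [linearDeriv_toeplitzProd_apply, Finset.sum_eq_single k]
  · rw [Pi.single_eq_same]
  · intro j _ hj
    rw [Pi.single_eq_of_ne hj]
    exact (toeplitzProdMultilinear n r).map_update_zero τ j
  · simp

/-! ### Varying one factor of a product -/

section Products

variable {A : Type*} [Ring A]

theorem prod_ofFn_add_one_add (F : ℕ → A) (k l : ℕ) (x : A) :
    (List.ofFn fun i : Fin (k + 1 + l) => Function.update F k x i).prod =
      (List.ofFn fun i : Fin k => F i).prod * x *
        (List.ofFn fun i : Fin l => F (k + 1 + i)).prod := by
  rw [List.ofFn_add, List.prod_append, List.ofFn_succ_last, List.prod_append]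
  congr 2
  · congr 2
    funext i
    exact Function.update_of_ne (by simp; omega) _ _
  · simp
  · congr 1
    funext i
    exact Function.update_of_ne (by simp; omega) _ _

/-- Moving a varied factor `x` from position `k` to position `k + 1` changes the product by a
commutator-like middle factor. -/
theorem prod_update_sub_prod_update (F : ℕ → A) (k l : ℕ) (x : A) :
    (List.ofFn fun i : Fin (k + 2 + l) => Function.update F (k + 1) x i).prod -
      (List.ofFn fun i : Fin (k + 2 + l) => Function.update F k x i).prod =
      (List.ofFn fun i : Fin k => F i).prod * (F k * x - x * F (k + 1)) *
        (List.ofFn fun i : Fin l => F (k + 2 + i)).prod := by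
  have h1 := prod_ofFn_add_one_add F (k + 1) l x
  have h2 := prod_ofFn_add_one_add F k (1 + l) x
  have h3 : (List.ofFn fun i : Fin (1 + l) => F (k + 1 + i)).prod =
      F (k + 1) * (List.ofFn fun i : Fin l => F (k + 2 + i)).prod := by
    rw [List.ofFn_add, List.prod_append]
    simp [add_assoc, ← add_assoc 1 1]
  have h4 : (List.ofFn fun i : Fin (k + 1) => F i).prod =
      (List.ofFn fun i : Fin k => F i).prod * F k := by
    rw [List.ofFn_succ_last, List.prod_append]
    simp
  have e : k + 1 + (1 + l) = k + 2 + l := by omega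
  rw [e] at h2
  rw [h1, h2, h3, h4]
  noncomm_ring

theorem continuous_prod_ofFn {B : Type*} [TopologicalSpace B] [TopologicalSpace A]
    [ContinuousMul A] {F : B → ℕ → A} (hF : ∀ i, Continuous fun t => F t i) (k l : ℕ) :
    Continuous fun t => (List.ofFn fun i : Fin l => F t (k + i)).prod := by
  simp_rw [List.ofFn_eq_map]
  exact continuous_list_prod _ fun i _ => hF _

end Products

/-! ### Limits of families of subspaces -/

/-- The limits at `0` of continuous curves `v` with `v t ∈ V t` for `t ≠ 0`. -/
def limitSubmodule {E : Type*} [AddCommGroup E] [Module ℂ E] [TopologicalSpace E]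
    [IsTopologicalAddGroup E] [ContinuousConstSMul ℂ E] (V : ℂ → Submodule ℂ E) :
    Submodule ℂ E where
  carrier := {e | ∃ v : ℂ → E, Continuous v ∧ v 0 = e ∧ ∀ t ≠ 0, v t ∈ V t}
  zero_mem' := ⟨0, continuous_zero, rfl, fun t _ => (V t).zero_mem⟩
  add_mem' := by
    rintro _ _ ⟨v, hv, rfl, hvV⟩ ⟨w, hw, rfl, hwV⟩
    exact ⟨v + w, hv.add hw, rfl, fun t ht => (V t).add_mem (hvV t ht) (hwV t ht)⟩
  smul_mem' := by
    rintro c _ ⟨v, hv, rfl, hvV⟩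
    exact ⟨c • v, hv.const_smul c, rfl, fun t ht => (V t).smul_mem c (hvV t ht)⟩

theorem eq_top_of_det_ne_zero {n : ℕ} {S : Submodule ℂ (Matrix (Fin n) (Fin n) ℂ)}
    {v : Fin n × Fin n → Matrix (Fin n) (Fin n) ℂ} (hv : ∀ p, v p ∈ S)
    (h : (Matrix.of fun p q : Fin n × Fin n => v p q.1 q.2).det ≠ 0) : S = ⊤ := by
  refine Submodule.eq_top_iff'.2 fun N => ?_
  set B := Matrix.of fun p q : Fin n × Fin n => v p q.1 q.2 with hB
  have hu : IsUnit B.det := isUnit_iff_ne_zero.2 h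
  have key : N = ∑ p, Matrix.vecMul (fun q : Fin n × Fin n => N q.1 q.2) B⁻¹ p • v p := by
    ext i j
    have h1 : Matrix.vecMul (Matrix.vecMul (fun q : Fin n × Fin n => N q.1 q.2) B⁻¹) B (i, j) =
        N i j := by
      rw [Matrix.vecMul_vecMul, Matrix.nonsing_inv_mul _ hu, Matrix.vecMul_one]
    rw [← h1, Matrix.sum_apply]
    simp only [Matrix.smul_apply, smul_eq_mul]
    rfl
  rw [key]
  exact S.sum_mem fun p _ => S.smul_mem _ (hv p)

theorem det_single (n : ℕ) :
    (Matrix.of fun p q : Fin n × Fin n =>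
      (Matrix.single p.1 p.2 (1 : ℂ) : Matrix (Fin n) (Fin n) ℂ) q.1 q.2).det = 1 := by
  convert Matrix.det_one (n := Fin n × Fin n) (R := ℂ)
  ext p q
  simp [Matrix.single_apply, Matrix.one_apply, Prod.ext_iff]

/-- If the limits of the spaces `V t` fill everything, so do the spaces `V t` for small `t ≠ 0`: the
determinant of curves tending to the standard basis is continuous. -/
theorem exists_eq_top_of_limitSubmodule_eq_top {n : ℕ}
    {V : ℂ → Submodule ℂ (Matrix (Fin n) (Fin n) ℂ)} (h : limitSubmodule V = ⊤) :
    ∃ t, V t = ⊤ := by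
  have hall : ∀ p : Fin n × Fin n, Matrix.single p.1 p.2 (1 : ℂ) ∈ limitSubmodule V :=
    fun p => h ▸ Submodule.mem_top
  choose v hv hv0 hvV using hall
  have hc : Continuous fun t => (Matrix.of fun p q : Fin n × Fin n => v p t q.1 q.2).det :=
    Continuous.matrix_det (continuous_matrix fun p q => (hv p).matrix_elem q.1 q.2)
  have h0 : (Matrix.of fun p q : Fin n × Fin n => v p 0 q.1 q.2).det ≠ 0 := by
    simp only [hv0, det_single]
    exact one_ne_zero
  have h1 := (hc.continuousAt (x := 0)).eventually_ne h0
  obtain ⟨t, ht, ht0⟩ := ((h1.filter_mono nhdsWithin_le_nhds).and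
    (self_mem_nhdsWithin (s := {0}ᶜ))).exists
  exact ⟨t, eq_top_of_det_ne_zero (fun p => hvV p t ht0) ht⟩

/-! ### A point where the differential is onto -/

/-- A curve of tuples of Toeplitz matrices through the tuple of identity matrices. The different
powers of `t` make the derivatives at the various positions of different orders in `t`. -/
noncomputable def toeplitzCurve (n r : ℕ) (t : ℂ) (i : Fin r) : toeplitz n :=
  ⟨1 + t ^ ((i : ℕ) + 1) • rowSwap n i, (toeplitz n).add_mem
    (by
      intro i j k l h
      simp only [Matrix.one_apply]
      congr 1
      simp only [eq_iff_iff, Fin.ext_iff]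
      omega)
    ((toeplitz n).smul_mem _ (toeplitzOf_mem _ _))⟩

/-- A Toeplitz matrix `X` is the limit of the products with `X` in the first position, and
`rowSwap n k * X` is the limit of the rescaled differences between the products with `X` in two
neighbouring positions. -/
theorem limitSubmodule_toeplitzCurve_eq_top {n r : ℕ} (hr : n / 2 + 1 ≤ r) :
    limitSubmodule (fun t =>
      ((toeplitzProdMultilinear n r).linearDeriv (toeplitzCurve n r t)).range) = ⊤ := by
  let F : ℂ → ℕ → Matrix (Fin n) (Fin n) ℂ := fun t i => 1 + t ^ (i + 1) • rowSwap n i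
  have hF : ∀ i, Continuous fun t => F t i := fun i => by
    simp only [F]
    fun_prop
  have hF0 : ∀ i, F 0 i = 1 := fun i => by simp [F]
  have hmem : ∀ t, ∀ k < r, ∀ x, (List.ofFn fun i : Fin r =>
      Function.update (F t) k (toeplitzOf n x) i).prod ∈
        ((toeplitzProdMultilinear n r).linearDeriv (toeplitzCurve n r t)).range := by
    intro t k hk x
    convert prod_update_mem_range (toeplitzCurve n r t) ⟨k, hk⟩ ⟨_, toeplitzOf_mem n x⟩ using 4
      with i
    by_cases hi : (i : ℕ) = k
    · subst hi
      simp
    · rw [Function.update_of_ne hi, Function.update_of_ne (fun h => hi (congrArg Fin.val h))]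
      rfl
  refine eq_top_of_toeplitz_of_rowSwap_mul (fun x => ?_) (fun k hk x => ?_)
  · obtain ⟨l, rfl⟩ : ∃ l, r = 0 + 1 + l := ⟨r - 1, by omega⟩
    refine ⟨fun t => toeplitzOf n x * (List.ofFn fun i : Fin l => F t (1 + i)).prod,
      continuous_const.mul (continuous_prod_ofFn hF _ _), by simp [hF0], fun t _ => ?_⟩
    have := hmem t 0 (by omega) x
    rw [prod_ofFn_add_one_add] at this
    simpa using this
  · obtain ⟨l, rfl⟩ : ∃ l, r = k + 2 + l := ⟨r - (k + 2), by omega⟩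
    refine ⟨fun t => (List.ofFn fun i : Fin k => F t (0 + i)).prod *
      (rowSwap n k * toeplitzOf n x - t • (toeplitzOf n x * rowSwap n (k + 1))) *
        (List.ofFn fun i : Fin l => F t (k + 2 + i)).prod, ?_, by simp [hF0], fun t ht => ?_⟩
    · have := continuous_prod_ofFn hF 0 k
      have := continuous_prod_ofFn hF (k + 2) l
      fun_prop
    · have := Submodule.smul_mem _ ((t ^ (k + 1))⁻¹)
        (Submodule.sub_mem _ (hmem t (k + 1) (by omega) x) (hmem t k (by omega) x))
      rw [prod_update_sub_prod_update] at this
      have e : F t k * toeplitzOf n x - toeplitzOf n x * F t (k + 1) =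
          t ^ (k + 1) •
            (rowSwap n k * toeplitzOf n x - t • (toeplitzOf n x * rowSwap n (k + 1))) := by
        simp only [F, add_mul, mul_add, one_mul, mul_one, smul_sub, smul_smul, smul_mul_assoc,
          mul_smul_comm, ← pow_succ]
        abel
      rw [e, mul_smul_comm, smul_mul_assoc, smul_smul,
        inv_mul_cancel₀ (pow_ne_zero _ ht), one_smul] at this
      simpa using this

theorem exists_linearDeriv_range_eq_top {n r : ℕ} (hr : n / 2 + 1 ≤ r) :
    ∃ τ : Fin r → toeplitz n, ((toeplitzProdMultilinear n r).linearDeriv τ).range = ⊤ := by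
  obtain ⟨t, ht⟩ := exists_eq_top_of_limitSubmodule_eq_top (limitSubmodule_toeplitzCurve_eq_top hr)
  exact ⟨_, ht⟩

/-! ### Images of dominant polynomial maps -/

/-- A polynomial map with algebraically independent components is dominant, so by Chevalley's
theorem and the Nullstellensatz its image contains the complement of a hypersurface. -/
theorem exists_ne_zero_forall_exists_eval_eq {K σ ι : Type*} [Field K] [IsAlgClosed K]
    [Finite σ] [Finite ι] {g : ι → MvPolynomial σ K}
    (hg : AlgebraicIndependent K g) :
    ∃ p : MvPolynomial ι K, p ≠ 0 ∧
      ∀ y : ι → K, MvPolynomial.eval y p ≠ 0 → ∃ x, ∀ i, MvPolynomial.eval x (g i) = y i := by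
  set f : MvPolynomial ι K →ₐ[K] MvPolynomial σ K := MvPolynomial.aeval g with hf
  have hinj : Function.Injective f := hg
  have hfp : f.toRingHom.FinitePresentation := by
    have h1 : (algebraMap K (MvPolynomial ι K)).FiniteType :=
      RingHom.finiteType_algebraMap.2 inferInstance
    have h2 : (f.toRingHom.comp (algebraMap K (MvPolynomial ι K))).FinitePresentation := by
      have : f.toRingHom.comp (algebraMap K (MvPolynomial ι K)) = algebraMap K _ :=
        f.comp_algebraMap
      rw [this]
      exact RingHom.finitePresentation_algebraMap.2 inferInstance
    exact RingHom.FinitePresentation.of_comp_finiteType _ h2 h1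
  obtain ⟨D, hD⟩ := PrimeSpectrum.exists_constructibleSetData_iff.2
    (PrimeSpectrum.isConstructible_range_comap hfp)
  -- The generic point lies in the image, hence in one of the locally closed pieces of the image;
  -- this piece is the complement of a hypersurface.
  have hbot : (⊥ : PrimeSpectrum (MvPolynomial ι K)) ∈ D.toSet := by
    rw [hD]
    refine ⟨⊥, PrimeSpectrum.ext ?_⟩
    change Ideal.comap f.toRingHom ⊥ = ⊥
    exact Ideal.comap_bot_of_injective _ hinj
  obtain ⟨B, hB, hBbot⟩ := Set.mem_iUnion₂.1 hbot
  have hg0 : ∀ i, B.g i = 0 := fun i => by simpa using hBbot.1 ⟨i, rfl⟩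
  refine ⟨B.f, fun h => hBbot.2 (by simp [h]), fun y hy => ?_⟩
  let m : PrimeSpectrum (MvPolynomial ι K) :=
    ⟨MvPolynomial.vanishingIdeal K {y}, (MvPolynomial.isMaximal_iff_eq_vanishingIdeal_singleton.2
      ⟨y, rfl⟩).isPrime⟩
  have hm : m ∈ D.toSet := by
    refine Set.mem_iUnion₂.2 ⟨B, hB, ?_, ?_⟩
    · rintro _ ⟨i, rfl⟩
      rw [hg0 i]
      exact m.asIdeal.zero_mem
    · intro h
      have : B.f ∈ MvPolynomial.vanishingIdeal K {y} := h rfl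
      rw [MvPolynomial.mem_vanishingIdeal_singleton_iff] at this
      exact hy (by simpa using this)
  rw [hD] at hm
  obtain ⟨q, hq⟩ := hm
  obtain ⟨M, hM, hqM⟩ := Ideal.exists_le_maximal q.asIdeal q.isPrime.ne_top
  obtain ⟨x, rfl⟩ := MvPolynomial.isMaximal_iff_eq_vanishingIdeal_singleton.1 hM
  refine ⟨x, fun i => ?_⟩
  have h1 : (MvPolynomial.X i - MvPolynomial.C (y i) : MvPolynomial ι K) ∈ m.asIdeal := by
    change _ ∈ MvPolynomial.vanishingIdeal K {y}
    rw [MvPolynomial.mem_vanishingIdeal_singleton_iff]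
    simp
  rw [← hq] at h1
  have h2 : f (MvPolynomial.X i - MvPolynomial.C (y i)) ∈ q.asIdeal := h1
  have h3 := hqM h2
  rw [MvPolynomial.mem_vanishingIdeal_singleton_iff] at h3
  simpa [hf, sub_eq_zero] using h3

/-! ### Genericity of surjective differentials -/

theorem mapMatrix_sum_prod_update {n r : ℕ} {R S : Type*} [CommRing R] [CommRing S]
    (φ : R →+* S) (T X : Fin r → Matrix (Fin n) (Fin n) R) :
    φ.mapMatrix (∑ k, (List.ofFn (Function.update T k (X k))).prod) =
      ∑ k, (List.ofFn
        (Function.update (fun i => φ.mapMatrix (T i)) k (φ.mapMatrix (X k)))).prod := by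
  simp only [map_sum, map_list_prod, List.map_ofFn]
  refine Finset.sum_congr rfl fun k _ => ?_
  rw [Function.comp_update]
  rfl

/-- The set of points where the differential is onto is Zariski open: it contains the
nonvanishing locus of the determinant of the differential, restricted to any fixed
`n ^ 2`-dimensional space of directions. -/
theorem holdsGenerically_linearDeriv_range_eq_top {n r : ℕ} {τ₀ : Fin r → toeplitz n}
    (h : ((toeplitzProdMultilinear n r).linearDeriv τ₀).range = ⊤) :
    HoldsGenerically (toeplitzCoords n r) fun τ =>
      ((toeplitzProdMultilinear n r).linearDeriv τ).range = ⊤ := by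
  have hsurj : ∀ p : Fin n × Fin n, ∃ Y, (toeplitzProdMultilinear n r).linearDeriv τ₀ Y =
      Matrix.single p.1 p.2 (1 : ℂ) := fun p => LinearMap.range_eq_top.1 h _
  choose Y hY using hsurj
  let G : Fin r → Matrix (Fin n) (Fin n) (MvPolynomial (Fin r × Fin n × Fin n) ℂ) :=
    fun k => Matrix.of fun i j => MvPolynomial.X (k, i, j)
  let P : MvPolynomial (Fin r × Fin n × Fin n) ℂ :=
    (Matrix.of fun p q : Fin n × Fin n =>
      (∑ k, (List.ofFn (Function.update G k
        (MvPolynomial.C.mapMatrix (Y p k : Matrix (Fin n) (Fin n) ℂ)))).prod) q.1 q.2).det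
  have hP : ∀ τ, MvPolynomial.eval (toeplitzCoords n r τ) P =
      (Matrix.of fun p q : Fin n × Fin n =>
        (toeplitzProdMultilinear n r).linearDeriv τ (Y p) q.1 q.2).det := by
    intro τ
    rw [RingHom.map_det]
    congr 1
    ext p q
    have hG : ∀ i, (MvPolynomial.eval (toeplitzCoords n r τ)).mapMatrix (G i) = τ i := by
      intro i
      ext a b
      simp only [G, RingHom.mapMatrix_apply, Matrix.map_apply, Matrix.of_apply,
        MvPolynomial.eval_X]
      rfl
    have hC : ∀ M : Matrix (Fin n) (Fin n) ℂ,
        (MvPolynomial.eval (toeplitzCoords n r τ)).mapMatrix (MvPolynomial.C.mapMatrix M) = M := by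
      intro M
      ext a b
      simp
    have := mapMatrix_sum_prod_update (MvPolynomial.eval (toeplitzCoords n r τ)) G
      (fun k => MvPolynomial.C.mapMatrix (Y p k : Matrix (Fin n) (Fin n) ℂ))
    simp only [hG, hC] at this
    refine (congrFun (congrFun this q.1) q.2).trans ?_
    rw [Matrix.of_apply, linearDeriv_toeplitzProd_apply]
    refine congrFun (congrFun (Finset.sum_congr rfl fun k _ => ?_) q.1) q.2
    congr 2
    exact (Function.comp_update (fun x : toeplitz n => (x : Matrix (Fin n) (Fin n) ℂ)) τ k _).symm
  refine ⟨{τ | MvPolynomial.eval (toeplitzCoords n r τ) P = 0}, ⟨{P}, by simp⟩, ?_, ?_⟩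
  · intro huniv
    have h0 : MvPolynomial.eval (toeplitzCoords n r τ₀) P = 0 := by
      have : τ₀ ∈ (Set.univ : Set (Fin r → toeplitz n)) := Set.mem_univ _
      rwa [← huniv] at this
    rw [hP] at h0
    simp only [hY, det_single, one_ne_zero] at h0
  · intro τ hτ
    by_contra hne
    refine hτ (eq_top_of_det_ne_zero (fun p => ⟨Y p, rfl⟩) ?_)
    rw [Set.mem_ofPred_eq, hP] at hne
    exact hne

/-! ### The generic fibre is nonempty -/

/-- A polynomial vanishing on a neighbourhood of a point is zero. -/
theorem eq_zero_of_eventually_eval_eq_zero {ι : Type*} [Finite ι] {p : MvPolynomial ι ℂ}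
    {a : ι → ℂ} (h : ∀ᶠ y in nhds a, MvPolynomial.eval y p = 0) : p = 0 := by
  have := Fintype.ofFinite ι
  rw [nhds_pi, Filter.Eventually, Filter.mem_pi] at h
  obtain ⟨I, -, t, ht, hsub⟩ := h
  refine MvPolynomial.funext_set t (fun i => infinite_of_mem_nhds (a i) (ht i)) fun x hx => ?_
  rw [map_zero]
  exact hsub fun i _ => hx i (Set.mem_univ i)

/-- Where the differential is onto, the map is open, so that its image lies in no hypersurface and
its components are algebraically independent. -/
theorem holdsGenerically_exists_eq_toeplitzProd {n r : ℕ} {τ₀ : Fin r → toeplitz n}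
    (h : ((toeplitzProdMultilinear n r).linearDeriv τ₀).range = ⊤) :
    HoldsGenerically (matrixCoords n) fun A => ∃ T, A = toeplitzProd n r T := by
  let b := Module.finBasis ℂ (toeplitz n)
  let G : Fin r → Matrix (Fin n) (Fin n)
      (MvPolynomial (Fin r × Fin (Module.finrank ℂ (toeplitz n))) ℂ) :=
    fun k => ∑ j, (MvPolynomial.X (k, j) : MvPolynomial _ ℂ) •
      MvPolynomial.C.mapMatrix (b j : Matrix (Fin n) (Fin n) ℂ)
  let g : Fin n × Fin n → MvPolynomial (Fin r × Fin (Module.finrank ℂ (toeplitz n))) ℂ :=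
    fun p => (List.ofFn G).prod p.1 p.2
  have hg : ∀ x p, MvPolynomial.eval x (g p) =
      toeplitzProd n r (fun k => ∑ j, x (k, j) • b j) p.1 p.2 := by
    intro x p
    have hG : ∀ k, (MvPolynomial.eval x).mapMatrix (G k) =
        ((∑ j, x (k, j) • b j : toeplitz n) : Matrix (Fin n) (Fin n) ℂ) := by
      intro k
      ext i j
      simp [G, Matrix.sum_apply]
    have : (MvPolynomial.eval x).mapMatrix (List.ofFn G).prod =
        toeplitzProd n r (fun k => ∑ j, x (k, j) • b j) := by
      rw [map_list_prod, List.map_ofFn, toeplitzProd]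
      congr 2
      funext k
      exact hG k
    exact congrFun (congrFun this p.1) p.2
  have hind : AlgebraicIndependent ℂ g := by
    rw [algebraicIndependent_iff]
    intro p hp
    have hz : ∀ τ, MvPolynomial.eval (matrixCoords n (toeplitzProd n r τ)) p = 0 := by
      intro τ
      have h1 := congrArg (MvPolynomial.eval fun kj : Fin r × _ => b.repr (τ kj.1) kj.2) hp
      rw [map_zero, ← MvPolynomial.coe_aeval_eq_eval, RingHom.coe_coe,
        MvPolynomial.comp_aeval_apply] at h1
      have hval : (fun q => MvPolynomial.aeval
          (fun kj : Fin r × _ => b.repr (τ kj.1) kj.2) (g q)) = matrixCoords n (toeplitzProd n r τ) := by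
        funext q
        refine (hg _ q).trans ?_
        simp only [Module.Basis.sum_repr]
        rfl
      rwa [hval, MvPolynomial.aeval_eq_eval] at h1
    have hnhds : ∀ᶠ A in nhds (toeplitzProd n r τ₀),
        MvPolynomial.eval (matrixCoords n A) p = 0 := by
      rw [← map_nhds_toeplitzProd h]
      exact Filter.eventually_map.2 (Filter.Eventually.of_forall hz)
    have hc : Filter.Tendsto (fun y : Fin n × Fin n → ℂ => Matrix.of fun i j => y (i, j))
        (nhds (matrixCoords n (toeplitzProd n r τ₀))) (nhds (toeplitzProd n r τ₀)) :=
      (continuous_matrix fun i j => continuous_apply (i, j)).tendsto' _ _ rfl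
    exact eq_zero_of_eventually_eval_eq_zero (hc.eventually hnhds)
  obtain ⟨p, hp0, hp⟩ := exists_ne_zero_forall_exists_eval_eq hind
  refine ⟨{A | MvPolynomial.eval (matrixCoords n A) p = 0}, ⟨{p}, by simp⟩, fun huniv => hp0 ?_, ?_⟩
  · refine MvPolynomial.funext fun y => ?_
    have : (Matrix.of fun i j => y (i, j)) ∈ (Set.univ : Set (Matrix (Fin n) (Fin n) ℂ)) :=
      Set.mem_univ _
    rw [← huniv] at this
    rw [map_zero]
    exact this
  · intro A hA
    by_contra hne
    obtain ⟨x, hx⟩ := hp (matrixCoords n A) hne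
    refine hA ⟨fun k => ∑ j, x (k, j) • b j, ?_⟩
    ext i j
    exact ((hg x (i, j)).symm.trans (hx (i, j))).symm

theorem mainTheorem1 (n : ℕ) :
    (∀ r : ℕ, n / 2 + 1 ≤ r →
      HoldsGenerically (toeplitzCoords n r) fun τ : Fin r → toeplitz n =>
        DifferentiableAt ℂ (toeplitzProd n r) τ ∧
          Module.finrank ℂ (fderiv ℂ (toeplitzProd n r) τ).range = n ^ 2) ∧
    HoldsGenerically (matrixCoords n) fun A : Matrix (Fin n) (Fin n) ℂ =>
      ∃ T : Fin (n / 2 + 1) → toeplitz n, A = toeplitzProd n (n / 2 + 1) T := by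
  refine ⟨fun r hr => ?_, ?_⟩
  · obtain ⟨τ₀, h₀⟩ := exists_linearDeriv_range_eq_top hr
    obtain ⟨Z, hZ, hne, hsub⟩ := holdsGenerically_linearDeriv_range_eq_top h₀
    refine ⟨Z, hZ, hne, fun τ hτ => hsub fun hτ' => hτ ?_⟩
    refine ⟨differentiableAt_toeplitzProd n r τ, ?_⟩
    rw [fderiv_toeplitzProd, hτ', finrank_top, Module.finrank_matrix]
    simp [sq]
  · obtain ⟨τ₀, h₀⟩ := exists_linearDeriv_range_eq_top (le_refl (n / 2 + 1))
    exact holdsGenerically_exists_eq_toeplitzProd h₀
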